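/- Let $F$ be the free group freely generated by a finite set $\mathcal A$ with $|\mathcal A|=m\ge 2$. Let $\partial F$ be its boundary, i.e. the space of infinite freely reduced words in the alphabet $\mathcal A\sqcup\mathcal A^{-1}$ with the topology of pointwise convergence and its Borel $\sigma$-algebra. The group $F$ acts on $\partial F$ by concatenation of words followed by free reduction. Let $\mathbf m$ be the uniform probability measure on $\partial F$, i.e. the one for which the set of all infinite words beginning with a given reduced word of length $n\ge 1$ has measure $\frac{1}{2m(2m-1)^{n-1}}$. Let $H\le F$ be a finitely generated subgroup. Then one of the following holds: either (i) $H$ has finite index in $F$, and its action on $(\partial F,\mathbf m)$ is ergodic and conservative; or (ii) $H$ has infinite index in $F$, and its action on $(\partial F,\mathbf m)$ is completely dissipative. Here the action is *ergodic* if every measurable set $A$ that is $H$-invariant mod $0$ satisfies $\mathbf m(A)=0$ or $\mathbf m(\partial F\setminus A)=0$. It is *conservative* if for every measurable set $A$ of positive measure and almost every $x\in A$ there is $h\in H$, $h\ne e$, with $hx\in A$. It is *completely dissipative* if there is a measurable set $A$ whose translates $hA$, $h\in H$, are pairwise disjoint and cover $\partial F$ up to an $\mathbf m$-null set. -/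

import Mathlib

open MeasureTheory ProbabilityTheory
open scoped Pointwise ENNReal

/-! ### Ergodic-theoretic notions for a group action on a measure space

These are the standard notions for a countable group acting by measure class preserving
transformations; as usual, all of them are understood modulo null sets. -/

section GroupActions

variable (G : Type*) [Group G] {X : Type*} [MulAction G X] [MeasurableSpace X]

/-- A measurable set is recurrent if almost every one of its points is brought back to it by some
non-identity element of the group. -/
def IsRecurrentSet (μ : Measure X) (A : Set X) : Prop :=
  MeasurableSet A ∧ ∀ᵐ x ∂μ, x ∈ A → ∃ g : G, g ≠ 1 ∧ g • x ∈ A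

/-- A measurable set is wandering if its translates by the elements of the group are pairwise
disjoint. -/
def IsWanderingSet (A : Set X) : Prop :=
  MeasurableSet A ∧ ∀ g h : G, g ≠ h → Disjoint (g • A) (h • A)

/-- The action is conservative if every measurable set of positive measure is recurrent. -/
def IsConservativeAction (μ : Measure X) : Prop :=
  ∀ A : Set X, MeasurableSet A → 0 < μ A → IsRecurrentSet G μ A

/-- The action is completely dissipative if, up to a null set, the whole space is the union of the
translates of some wandering set. -/
def IsCompletelyDissipativeAction (μ : Measure X) : Prop :=
  ∃ A : Set X, IsWanderingSet G A ∧ μ (⋃ g : G, g • A)ᶜ = 0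

/-- The action is ergodic if every (mod 0) invariant measurable set is null or conull. -/
def IsErgodicAction (μ : Measure X) : Prop :=
  ∀ A : Set X, MeasurableSet A → (∀ g : G, g • A =ᵐ[μ] A) → μ A = 0 ∨ μ Aᶜ = 0

end GroupActions

/-! ### The boundary of a free group -/

/-- The symmetrized alphabet of `FreeGroup α`: `(a, true)` stands for the generator `a`, and
`(a, false)` for its inverse. It is a discrete space. -/
def FreeLetter (α : Type*) : Type _ := α × Bool

namespace FreeLetter

variable {α : Type*}

instance [Fintype α] : Fintype (FreeLetter α) := inferInstanceAs (Fintype (α × Bool))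
instance [Nonempty α] : Nonempty (FreeLetter α) := inferInstanceAs (Nonempty (α × Bool))
instance : TopologicalSpace (FreeLetter α) := ⊥
instance : DiscreteTopology (FreeLetter α) := ⟨rfl⟩
instance : MeasurableSpace (FreeLetter α) := ⊤
instance : DiscreteMeasurableSpace (FreeLetter α) := ⟨fun _ => trivial⟩
instance : BorelSpace (FreeLetter α) := ⟨by
  rw [borel_eq_top_of_discrete]
  rfl⟩

/-- The formal inverse of a letter. -/
def inv (x : FreeLetter α) : FreeLetter α := (x.1, !x.2)

@[simp] theorem inv_inv (x : FreeLetter α) : x.inv.inv = x := by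
  obtain ⟨a, b⟩ := x
  cases b <;> rfl

theorem ne_inv (x : FreeLetter α) : x ≠ x.inv := by
  obtain ⟨a, b⟩ := x
  intro h
  have h2 : b = !b := congrArg Prod.snd h
  cases b <;> simp at h2

/-- The letters that may follow `x` in a freely reduced word. -/
abbrev Next (x : FreeLetter α) : Type _ := {y : FreeLetter α // y ≠ x.inv}

instance (x : FreeLetter α) : Nonempty x.Next := ⟨⟨x, x.ne_inv⟩⟩

end FreeLetter

/-- The boundary of `FreeGroup α`: infinite freely reduced words in the generators and their
inverses. -/
def FreeBoundary (α : Type*) : Type _ :=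
  {w : ℕ → FreeLetter α // ∀ n, w (n + 1) ≠ (w n).inv}

namespace FreeBoundary

variable {α : Type*}

/-- The topology of pointwise convergence. -/
instance : TopologicalSpace (FreeBoundary α) :=
  inferInstanceAs
    (TopologicalSpace {w : ℕ → FreeLetter α // ∀ n, w (n + 1) ≠ (w n).inv})

instance : MeasurableSpace (FreeBoundary α) := borel _
instance : BorelSpace (FreeBoundary α) := ⟨rfl⟩

theorem measurable_coord (n : ℕ) : Measurable fun w : FreeBoundary α => w.1 n := by
  have h : Continuous fun w : FreeBoundary α => w.1 n := (continuous_apply n).comp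
    (continuous_subtype_val (p := fun w : ℕ → FreeLetter α => ∀ n, w (n + 1) ≠ (w n).inv))
  exact h.measurable

/-- Deletion of the first letter. -/
def tail (w : FreeBoundary α) : FreeBoundary α := ⟨fun n => w.1 (n + 1), fun n => w.2 (n + 1)⟩

/-- The word `x w`, if it is freely reduced. -/
def cons (x : FreeLetter α) (w : FreeBoundary α) (h : w.1 0 ≠ x.inv) : FreeBoundary α :=
  ⟨fun n => Nat.casesOn n x w.1, fun n => by
    cases n with
    | zero => exact h
    | succ k => exact w.2 k⟩

open Classical in
/-- Concatenation of a letter with an infinite reduced word, followed by free reduction. -/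
noncomputable def letterMul (x : FreeLetter α) (w : FreeBoundary α) : FreeBoundary α :=
  if h : w.1 0 = x.inv then w.tail else cons x w h

theorem letterMul_inv_letterMul (x : FreeLetter α) (w : FreeBoundary α) :
    letterMul x.inv (letterMul x w) = w := by
  by_cases h : w.1 0 = x.inv
  · have h1 : w.tail.1 0 ≠ x := by
      have := w.2 0
      rw [h, FreeLetter.inv_inv] at this
      exact this
    have h2 : letterMul x w = w.tail := by simp [letterMul, h]
    rw [h2]
    have h3 : ¬ w.tail.1 0 = x.inv.inv := by simpa using h1
    rw [letterMul, dif_neg h3]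
    apply Subtype.ext
    funext n
    cases n with
    | zero => exact h.symm
    | succ k => rfl
  · have h2 : letterMul x w = cons x w h := by simp [letterMul, h]
    rw [h2]
    have h3 : (cons x w h).1 0 = x.inv.inv := by
      rw [FreeLetter.inv_inv]
      rfl
    rw [letterMul, dif_pos h3]
    rfl

/-- Multiplication by a letter, as a bijection of the boundary. -/
noncomputable def letterPerm (x : FreeLetter α) : Equiv.Perm (FreeBoundary α) where
  toFun := letterMul x
  invFun := letterMul x.inv
  left_inv := letterMul_inv_letterMul x
  right_inv := fun w => by
    have h := letterMul_inv_letterMul x.inv w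
    rwa [FreeLetter.inv_inv] at h

/-- The boundary action of the free group: concatenation of words followed by free reduction. -/
noncomputable instance : MulAction (FreeGroup α) (FreeBoundary α) :=
  MulAction.compHom _ (FreeGroup.lift fun a : α => letterPerm ((a, true) : α × Bool))

theorem mk_singleton_smul (x : α × Bool) (w : FreeBoundary α) :
    FreeGroup.mk [x] • w = letterMul x w := by
  obtain ⟨a, b⟩ := x
  change (FreeGroup.lift (fun a : α => letterPerm ((a, true) : α × Bool))) _ w = _
  cases b <;> simp [FreeGroup.lift_mk] <;> rfl

/-- The cylinder set of `g`: infinite words that begin with the reduced word of `g`. -/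
def cylinder [DecidableEq α] (g : FreeGroup α) : Set (FreeBoundary α) :=
  {w | ∀ (i : ℕ) (hi : i < g.toWord.length), w.1 i = g.toWord[i]}

/-! ### The uniform measure

A random infinite reduced word is built letter by letter: the first letter is uniformly
distributed on the whole alphabet, and if the letter number `n` is `x`, then the letter number
`n + 1` is given by an independent choice, uniformly distributed on all the letters except for
the inverse of `x`. -/

section UniformMeasure

/-- The space of choices: a first letter and, for any position `n` and any letter `x`, a letter to
be put after `x` if `x` occupies the position `n`. -/
abbrev Choices (α : Type*) : Type _ :=
  FreeLetter α × ((p : ℕ × FreeLetter α) → p.2.Next)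

/-- The sequence of letters determined by the choices. -/
def choicesSeq (s : Choices α) : ℕ → FreeLetter α
  | 0 => s.1
  | n + 1 => (s.2 (n, choicesSeq s n)).1

/-- The infinite reduced word determined by the choices. -/
def ofChoices (s : Choices α) : FreeBoundary α :=
  ⟨choicesSeq s, fun n => (s.2 (n, choicesSeq s n)).2⟩

variable [Fintype α]

instance (x : FreeLetter α) :
    IsProbabilityMeasure (uniformOn (Set.univ : Set x.Next)) :=
  isProbabilityMeasure_uniformOn Set.finite_univ Set.univ_nonempty

/-- All the choices are independent and uniformly distributed. -/
noncomputable def choicesMeasure (α : Type*) [Fintype α] : Measure (Choices α) :=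
  (uniformOn (Set.univ : Set (FreeLetter α))).prod
    (Measure.infinitePi fun p : ℕ × FreeLetter α => uniformOn (Set.univ : Set p.2.Next))

/-- The uniform measure on the boundary of the free group. -/
noncomputable def uniformMeasure (α : Type*) [Fintype α] : Measure (FreeBoundary α) :=
  (choicesMeasure α).map ofChoices

theorem measurable_choicesSeq (n : ℕ) : Measurable fun s : Choices α => choicesSeq s n := by
  induction n with
  | zero => exact measurable_fst
  | succ n ih =>
    refine measurable_to_countable' fun y => ?_
    have : (fun s : Choices α => choicesSeq s (n + 1)) ⁻¹' {y} =
        ⋃ x : FreeLetter α, (fun s : Choices α => choicesSeq s n) ⁻¹' {x} ∩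
          (fun s : Choices α => (s.2 (n, x)).1) ⁻¹' {y} := by
      ext s
      simp [choicesSeq]
    rw [this]
    refine MeasurableSet.iUnion fun x => (ih (measurableSet_singleton x)).inter ?_
    have : Measurable fun s : Choices α => (s.2 (n, x)).1 :=
      measurable_subtype_coe.comp ((measurable_pi_apply (n, x)).comp measurable_snd)
    exact this (measurableSet_singleton y)

theorem measurable_ofChoices : Measurable (ofChoices : Choices α → FreeBoundary α) := by
  have hB : BorelSpace {w : ℕ → FreeLetter α // ∀ n, w (n + 1) ≠ (w n).inv} := inferInstance
  have h2 : Measurable (fun s : Choices α =>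
      (⟨choicesSeq s, fun n => (s.2 (n, choicesSeq s n)).2⟩ :
        {w : ℕ → FreeLetter α // ∀ n, w (n + 1) ≠ (w n).inv})) :=
    (measurable_pi_lambda _ measurable_choicesSeq).subtype_mk
  intro A hA
  refine h2 ?_
  rw [hB.measurable_eq]
  exact hA

instance [Nonempty α] : IsProbabilityMeasure (uniformMeasure α) := by
  have : IsProbabilityMeasure (uniformOn (Set.univ : Set (FreeLetter α))) :=
    isProbabilityMeasure_uniformOn Set.finite_univ Set.univ_nonempty
  have : IsProbabilityMeasure (choicesMeasure α) := by
    unfold choicesMeasure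
    infer_instance
  exact Measure.isProbabilityMeasure_map measurable_ofChoices.aemeasurable

/-- The cylinder sets of the same dimension have equal measure. -/
theorem uniformMeasure_cylinder [DecidableEq α] (g : FreeGroup α) (hg : g ≠ 1) :
    uniformMeasure α (cylinder g) =
      ((2 * Fintype.card α * (2 * Fintype.card α - 1) ^ (g.norm - 1) : ℕ) : ℝ≥0∞)⁻¹ := by
  classical
  obtain ⟨x, l, hl⟩ : ∃ x l, g.toWord = x :: l := List.exists_cons_of_ne_nil (by simpa using hg)
  have hred : FreeGroup.IsReduced (x :: l) := hl ▸ FreeGroup.isReduced_toWord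
  have hnorm : g.norm - 1 = l.length := by simp [FreeGroup.norm, hl]
  have hx : Nonempty (FreeLetter α) := ⟨x⟩
  have hnext : ∀ i (hi : i < l.length),
      (show FreeLetter α from l[i]) ≠ FreeLetter.inv ((x :: l)[i]'(by simp; omega)) := by
    intro i hi h
    have h1 := List.isChain_iff_getElem.1 hred i (by simp; omega)
    simp only [List.getElem_cons_succ] at h1
    have h2 : l[i] = (((x :: l)[i]'(by simp; omega)).1, !((x :: l)[i]'(by simp; omega)).2) := h
    have h3 := h1 (by rw [h2])
    rw [h2] at h3
    simp at h3
  let u : ℕ → FreeLetter α := fun i => (x :: l).getD i x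
  have hu : ∀ i (hi : i < (x :: l).length), u i = (x :: l)[i] := fun i hi => by
    simp only [u]
    exact List.getD_eq_getElem _ _ hi
  have hpre : ofChoices ⁻¹' (cylinder g) =
      ({x} : Set (FreeLetter α)) ×ˢ
        Set.pi (((Finset.range l.length).image fun i => (i, u i) : Finset (ℕ × FreeLetter α)) :
          Set (ℕ × FreeLetter α)) (fun p => {y : p.2.Next | y.1 = u (p.1 + 1)}) := by
    ext s
    simp only [Set.mem_preimage, cylinder, Set.mem_ofPred_eq, Set.mem_prod,
      Set.mem_pi, Finset.coe_image, Finset.coe_range, Set.mem_image, Set.mem_Iio,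
      forall_exists_index, and_imp]
    have hc : (∀ (i : ℕ) (hi : i < g.toWord.length), (ofChoices s).1 i = g.toWord[i]) ↔
        ∀ i, i < l.length + 1 → choicesSeq s i = u i := by
      simp only [hl]
      exact forall_congr' fun i => forall_congr' fun hi => by rw [hu i hi]; rfl
    rw [hc]
    constructor
    · intro h
      refine ⟨h 0 (by omega), ?_⟩
      rintro _ i hi rfl
      have h1 := h (i + 1) (by omega)
      rw [choicesSeq, h i (by omega)] at h1
      exact h1
    · rintro ⟨h0, h1⟩ i
      induction i with
      | zero => exact fun _ => h0
      | succ i ih =>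
        intro hi
        have h2 := h1 (i, u i) i (by omega) rfl
        rw [choicesSeq, ih (by omega)]
        exact h2
  have hmeas : MeasurableSet (cylinder g) := by
    have : cylinder g = ⋂ (i : ℕ) (hi : i < g.toWord.length),
        (fun w : FreeBoundary α => w.1 i) ⁻¹' {(g.toWord[i] : α × Bool)} := by
      ext w
      simp only [Set.mem_iInter]
      rfl
    rw [this]
    exact MeasurableSet.iInter fun i => MeasurableSet.iInter fun hi =>
      measurable_coord i (measurableSet_singleton _)
  have hcard : Fintype.card (FreeLetter α) = 2 * Fintype.card α := by
    rw [mul_comm]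
    change Fintype.card (α × Bool) = _
    simp
  have hcardN : ∀ y : FreeLetter α, Fintype.card y.Next = 2 * Fintype.card α - 1 := by
    intro y
    rw [← hcard]
    simp [FreeLetter.Next, Fintype.card_subtype_compl]
  have hsingle : ∀ i ∈ Finset.range l.length,
      uniformOn (Set.univ : Set (u i).Next) {y : (u i).Next | y.1 = u (i + 1)} =
        ((2 * Fintype.card α - 1 : ℕ) : ℝ≥0∞)⁻¹ := by
    intro i hi
    have hi' : i < l.length := Finset.mem_range.1 hi
    have h1 : u (i + 1) ≠ (u i).inv := by
      rw [hu i (by simp; omega), hu (i + 1) (by simpa using hi')]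
      exact hnext i hi'
    have h2 : {y : (u i).Next | y.1 = u (i + 1)} = {⟨u (i + 1), h1⟩} := by
      ext y
      simp [Subtype.ext_iff]
    rw [h2, uniformOn_univ, hcardN]
    simp
  have hfirst : uniformOn (Set.univ : Set (FreeLetter α)) {(x : FreeLetter α)} =
      ((2 * Fintype.card α : ℕ) : ℝ≥0∞)⁻¹ := by
    have h : ∀ y : FreeLetter α, uniformOn (Set.univ : Set (FreeLetter α)) {y} =
        ((2 * Fintype.card α : ℕ) : ℝ≥0∞)⁻¹ := fun y => by
      rw [uniformOn_univ, hcard]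
      simp
    exact h x
  rw [uniformMeasure, Measure.map_apply measurable_ofChoices hmeas, hpre, choicesMeasure,
    Measure.prod_prod, Measure.infinitePi_pi _ (fun _ _ => MeasurableSet.of_discrete),
    Finset.prod_image (fun a _ b _ h => congrArg Prod.fst h), Finset.prod_congr rfl hsingle,
    hnorm, Finset.prod_const, Finset.card_range, Nat.cast_mul (2 * Fintype.card α),
    ENNReal.mul_inv (Or.inr (ENNReal.natCast_ne_top _)) (Or.inl (ENNReal.natCast_ne_top _)),
    Nat.cast_pow, ENNReal.inv_pow]
  exact congrArg (· * _) hfirst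

end UniformMeasure

end FreeBoundary

/-! Both cases rest on the non-backtracking walk on the Schreier graph `FreeGroup α ⧸ H`. From a
state `(u, a)` it moves to `(b⁻¹ u, b)`, with `b ≠ a⁻¹` chosen uniformly among `q = 2m - 1` letters.
Suppose that sets `D g` of boundary points depend only on the coset `Hg`, and that a word of `D g`
with first letter `b` has its tail in `D (g b)`. By the Markov property (`uniformMeasure_tail`), the
measure of `D g ∩ {w₀ ≠ a⁻¹}` is then a subharmonic function of the state `(g⁻¹H, a)`. A finite
nonempty set of states closed under the walk is everything, so a nonnegative subharmonic function of
finite support is constant (`subharmonic_const`, `measure_inter_ne_const`).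

Finite index: for an `H`-invariant `A`, take `D g = g⁻¹A`. Constancy says that `A` has the same
density in all cylinders, hence in all Borel sets, its complement included, so `A` is null or
conull. Conservativity follows: a positive set of non-returning points would split, along a small
cylinder, into two positive pieces, and the saturation of one would miss the other.

Infinite index: a neighbourhood `Y` of `H` in the Cayley tree is an `H`-invariant proper subtree,
finite modulo `H` (`Subgroup.FG.exists_subtree`). Let `D g` describe the rays from `g` that stay in
`Y`. The resulting constant vanishes off `Y`, so it is zero, and almost every ray from `1` leaves
`Y`. The exit vertex is `H`-equivariant (`ExitsAt.smul`), so the words whose exit vertex lies in a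
transversal of `H` form a fundamental domain. -/

namespace FreeLetter

/-! ### Letters as group elements -/

variable {α : Type*}

/-- A letter as an element of the free group. -/
def gen (x : FreeLetter α) : FreeGroup α := FreeGroup.mk [(x : α × Bool)]

theorem gen_inv (x : FreeLetter α) : x.inv.gen = x.gen⁻¹ := by
  simp only [gen, FreeGroup.inv_mk]
  rfl

theorem eq_inv_comm {x y : FreeLetter α} : x = y.inv ↔ y = x.inv :=
  ⟨fun h => by simp [h], fun h => by simp [h]⟩

theorem gen_induction {p : FreeGroup α → Prop} (one : p 1)
    (mul : ∀ (x : FreeLetter α) g, p g → p (x.gen * g)) (g : FreeGroup α) : p g := by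
  obtain ⟨L, rfl⟩ := Quot.exists_rep g
  induction L with
  | nil => exact one
  | cons x L ih => exact mul x _ ih

variable [Fintype α]

theorem card_eq : Fintype.card (FreeLetter α) = 2 * Fintype.card α := by
  rw [mul_comm]
  change Fintype.card (α × Bool) = _
  simp

open Classical in
theorem card_filter_ne (a : FreeLetter α) :
    (Finset.univ.filter fun b => b ≠ a).card = 2 * Fintype.card α - 1 := by
  rw [Finset.filter_ne', Finset.card_erase_of_mem (Finset.mem_univ _), Finset.card_univ, card_eq]

theorem exists_ne_ne (hα : 2 ≤ Fintype.card α) (a c : FreeLetter α) :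
    ∃ b : FreeLetter α, b ≠ a ∧ b ≠ c := by
  classical
  by_contra! h
  have h1 : (Finset.univ : Finset (FreeLetter α)) ⊆ {a, c} := fun b _ => by
    by_cases hb : b = a
    · simp [hb]
    · simp [h b hb]
  have h2 := Finset.card_le_card h1
  rw [Finset.card_univ, card_eq] at h2
  have := Finset.card_le_two (a := a) (b := c)
  omega

/-! ### Maximum principle for the non-backtracking walk -/

section MaximumPrinciple

variable {S : Type*} [MulAction (FreeGroup α) S]

/-- A finite set of states of the non-backtracking walk which is closed under the transitions of
the walk is also closed under the inverse transitions. -/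
theorem mem_of_forward_closed {E : Set (S × FreeLetter α)} (hE : E.Finite)
    (hfor : ∀ u a, (u, a) ∈ E → ∀ b, b ≠ a.inv → (b.gen⁻¹ • u, b) ∈ E)
    {u : S} {b : FreeLetter α} (hu : (u, b) ∈ E) {a : FreeLetter α} (hab : a ≠ b.inv) :
    (b.gen • u, a) ∈ E := by
  let W : Set (S × FreeLetter α × FreeLetter α) := {p | (p.1, p.2.1) ∈ E ∧ p.2.2 ≠ p.2.1.inv}
  have hW : W.Finite := by
    refine Set.Finite.subset ((hE.prod (Set.finite_univ (α := FreeLetter α))).image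
      fun p => (p.1.1, p.1.2, p.2)) ?_
    rintro ⟨s, x, y⟩ h
    exact ⟨((s, x), y), ⟨h.1, trivial⟩, rfl⟩
  -- Make the step, then swap the two letters: the condition `y ≠ x⁻¹` is symmetric, so `W` is
  -- preserved. An injective self-map of a finite set is onto, and the preimage of `(u, b, a)` is
  -- the sought predecessor.
  let Φ : S × FreeLetter α × FreeLetter α → S × FreeLetter α × FreeLetter α :=
    fun p => (p.2.2.gen⁻¹ • p.1, p.2.2, p.2.1)
  have hmaps : Set.MapsTo Φ W W := by
    rintro ⟨s, x, y⟩ h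
    exact ⟨hfor s x h.1 y h.2, fun h' => h.2 (eq_inv_comm.1 h')⟩
  have hinj : Set.InjOn Φ W := by
    rintro ⟨s, x, y⟩ - ⟨s', x', y'⟩ - h
    simp only [Φ, Prod.mk.injEq] at h
    obtain ⟨h1, rfl, rfl⟩ := h
    simpa using h1
  have himage : Φ '' W = W := Set.eq_of_subset_of_ncard_le hmaps.image_subset
    (by rw [hinj.ncard_image]) hW
  obtain ⟨⟨s, x, y⟩, h, h'⟩ : (u, b, a) ∈ Φ '' W := by
    rw [himage]
    exact ⟨hu, hab⟩
  simp only [Φ, Prod.mk.injEq] at h'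
  obtain ⟨rfl, rfl, rfl⟩ := h'
  simpa using h.1

/-- A step forward followed by a step backward replaces the letter at a vertex by any other: the
intermediate letter has two values to avoid, and there are at least four letters. Once the letter is
free, every edge can be crossed, and transitivity does the rest. -/
theorem forward_closed_eq_univ [MulAction.IsPretransitive (FreeGroup α) S]
    (hα : 2 ≤ Fintype.card α) {E : Set (S × FreeLetter α)} (hE : E.Finite)
    (hfor : ∀ u a, (u, a) ∈ E → ∀ b, b ≠ a.inv → (b.gen⁻¹ • u, b) ∈ E) (hne : E.Nonempty) :
    E = Set.univ := by
  have hall : ∀ u a c, (u, a) ∈ E → (u, c) ∈ E := by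
    intro u a c h
    obtain ⟨b, hb, hbc⟩ := exists_ne_ne hα a.inv c.inv
    simpa using mem_of_forward_closed hE hfor (hfor u a h b hb)
      (fun h' => hbc (eq_inv_comm.1 h') : c ≠ b.inv)
  have hmove : ∀ u a (b : FreeLetter α) c, (u, a) ∈ E → (b.gen • u, c) ∈ E := by
    intro u a b c h
    have := hfor u b.inv (hall _ _ _ h) b.inv b.inv.ne_inv
    rw [gen_inv, _root_.inv_inv] at this
    exact hall _ _ _ this
  obtain ⟨⟨u, a⟩, h⟩ := hne
  refine Set.eq_univ_of_forall fun ⟨v, c⟩ => ?_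
  obtain ⟨g, rfl⟩ := MulAction.exists_smul_eq (FreeGroup α) u v
  refine hall _ a c ?_
  induction g using gen_induction with
  | one => simpa using h
  | mul x g ih =>
    rw [mul_smul]
    exact hmove _ _ _ _ ih

open Classical in
/-- The maximum principle for the non-backtracking walk: a finitely supported nonnegative
subharmonic function is constant. -/
theorem subharmonic_const [MulAction.IsPretransitive (FreeGroup α) S]
    (hα : 2 ≤ Fintype.card α) {C : Set S} (hC : C.Finite) {f : S → FreeLetter α → ℝ}
    (hf : ∀ u a, 0 ≤ f u a) (hfC : ∀ u a, u ∉ C → f u a = 0)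
    (hsub : ∀ u a, ((2 * Fintype.card α - 1 : ℕ) : ℝ) * f u a ≤
      ∑ b with b ≠ a.inv, f (b.gen⁻¹ • u) b) (u v : S) (a b : FreeLetter α) :
    f u a = f v b := by
  suffices h : ∃ M, ∀ u a, f u a = M by
    obtain ⟨M, hM⟩ := h
    rw [hM, hM]
  by_cases hzero : ∀ u a, f u a = 0
  · exact ⟨0, hzero⟩
  push Not at hzero
  obtain ⟨u₀, a₀, h₀⟩ := hzero
  have hCfin : (C ×ˢ (Set.univ : Set (FreeLetter α))).Finite := hC.prod Set.finite_univ
  have hmemC : ∀ u a, f u a ≠ 0 → (u, a) ∈ C ×ˢ (Set.univ : Set (FreeLetter α)) :=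
    fun u a h => ⟨by by_contra h'; exact h (hfC u a h'), trivial⟩
  obtain ⟨⟨u₁, a₁⟩, h₁, hmax⟩ := Set.exists_max_image _ (fun p => f p.1 p.2) hCfin
    ⟨(u₀, a₀), hmemC _ _ h₀⟩
  have hle : ∀ u a, f u a ≤ f u₁ a₁ := by
    intro u a
    by_cases h : f u a = 0
    · rw [h]
      exact hf _ _
    · exact hmax (u, a) (hmemC _ _ h)
  have hpos : f u₁ a₁ ≠ 0 :=
    (((hf _ _).lt_of_ne' h₀).trans_le (hle u₀ a₀)).ne'
  set M := f u₁ a₁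
  refine ⟨M, ?_⟩
  -- The maximum set is finite since `M ≠ 0` keeps it inside the support, and forward closed since
  -- an average reaching the maximum has all its terms maximal.
  have hEu := forward_closed_eq_univ hα (E := {p : S × FreeLetter α | f p.1 p.2 = M})
    (hCfin.subset fun p hp => hmemC _ _ (by rw [show f p.1 p.2 = M from hp]; exact hpos))
    (by
      intro u a h b hb
      have h : f u a = M := h
      have h1 := hsub u a
      rw [h] at h1
      have h2 : ∑ b with b ≠ a.inv, f (b.gen⁻¹ • u) b ≤
          ∑ b : FreeLetter α with b ≠ a.inv, M := Finset.sum_le_sum fun b _ => hle _ _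
      have h3 : ∑ b : FreeLetter α with b ≠ a.inv, M =
          ((2 * Fintype.card α - 1 : ℕ) : ℝ) * M := by
        rw [Finset.sum_const, card_filter_ne, nsmul_eq_mul]
      exact (Finset.sum_eq_sum_iff_of_le fun b _ => hle _ _).1 (h2.antisymm (h3 ▸ h1)) b
        (by simpa using hb))
    ⟨(u₁, a₁), rfl⟩
  intro u a
  exact (hEu ▸ Set.mem_univ (u, a) : (u, a) ∈ {p : S × FreeLetter α | f p.1 p.2 = M})

end MaximumPrinciple

end FreeLetter

/-! ### Prefixes and cylinders of infinite words -/

namespace FreeBoundary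

variable {α : Type*}

theorem gen_smul (x : FreeLetter α) (w : FreeBoundary α) : x.gen • w = letterMul x w :=
  mk_singleton_smul x w

theorem gen_smul_tail {w : FreeBoundary α} {b : FreeLetter α} (h : w.1 0 = b) :
    b.gen • w.tail = w := by
  have h1 : b.inv.gen • w = w.tail := by
    rw [gen_smul, letterMul, dif_pos (by rw [h, FreeLetter.inv_inv])]
  rw [← h1, FreeLetter.gen_inv, smul_inv_smul]

/-- The list of the first `n` letters of an infinite word. -/
def word (w : FreeBoundary α) (n : ℕ) : List (α × Bool) := List.ofFn fun i : Fin n => w.1 i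

/-- The prefix of length `n` of an infinite word, as an element of the free group. -/
def pre (w : FreeBoundary α) (n : ℕ) : FreeGroup α := FreeGroup.mk (w.word n)

@[simp] theorem length_word (w : FreeBoundary α) (n : ℕ) : (w.word n).length = n :=
  List.length_ofFn

theorem getElem_word (w : FreeBoundary α) (n i : ℕ) (hi : i < (w.word n).length) :
    (w.word n)[i] = w.1 i := by
  simp only [word]
  exact List.getElem_ofFn ..

theorem isReduced_word (w : FreeBoundary α) (n : ℕ) : FreeGroup.IsReduced (w.word n) := by
  refine List.isChain_iff_getElem.2 fun i hi h => ?_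
  simp only [getElem_word] at h ⊢
  by_contra h2
  refine w.2 i (Prod.ext h.symm ?_)
  change (w.1 (i + 1)).2 = !(w.1 i).2
  rcases h3 : (w.1 (i + 1)).2 <;> rcases h4 : (w.1 i).2 <;> simp_all

theorem take_word (w : FreeBoundary α) {i n : ℕ} (h : i ≤ n) :
    (w.word n).take i = w.word i := by
  refine List.ext_getElem (by simpa using h) fun j h1 h2 => ?_
  rw [List.getElem_take, getElem_word, getElem_word]

@[simp] theorem pre_zero (w : FreeBoundary α) : w.pre 0 = 1 := rfl

theorem pre_succ (w : FreeBoundary α) (n : ℕ) :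
    w.pre (n + 1) = FreeLetter.gen (w.1 0) * w.tail.pre n := by
  have h : w.word (n + 1) = w.1 0 :: w.tail.word n := List.ofFn_succ
  rw [pre, h]
  rfl

open Classical in
theorem toWord_pre (w : FreeBoundary α) (n : ℕ) : (w.pre n).toWord = w.word n := by
  rw [pre, FreeGroup.toWord_mk]
  exact (isReduced_word w n).reduce_eq

open Classical in
theorem norm_pre (w : FreeBoundary α) (n : ℕ) : (w.pre n).norm = n := by
  rw [FreeGroup.norm, toWord_pre, length_word]

/-- The infinite words which agree with a given sequence in the first `n` places. -/
def agree (v : ℕ → FreeLetter α) (n : ℕ) : Set (FreeBoundary α) := {w | ∀ i < n, w.1 i = v i}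

theorem setOf_word_eq {v : FreeBoundary α} {n : ℕ} {L : List (α × Bool)} (hv : v.word n = L) :
    {w : FreeBoundary α | w.word n = L} = agree v.1 n := by
  subst hv
  ext w
  constructor
  · intro hw i hi
    rw [← getElem_word w n i (by simpa using hi), ← getElem_word v n i (by simpa using hi)]
    exact List.getElem_of_eq hw _
  · intro hw
    refine List.ext_getElem (by simp) fun i h1 h2 => ?_
    rw [getElem_word, getElem_word]
    exact hw i (by simpa using h1)

open Classical in
theorem agree_eq_cylinder (w : FreeBoundary α) (n : ℕ) : agree w.1 n = cylinder (w.pre n) := by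
  ext w'
  simp only [agree, cylinder, toWord_pre, Set.mem_ofPred_eq, getElem_word, length_word]

/-- The boundary point `b b b ...`. -/
def const (b : FreeLetter α) : FreeBoundary α := ⟨fun _ => b, fun _ => b.ne_inv⟩

/-! ### Measurability and generation by cylinders -/

section Measurability

theorem measurable_of_coord {X : Type*} [MeasurableSpace X] {f : X → FreeBoundary α}
    (hf : ∀ n, Measurable fun x => (f x).1 n) [Fintype α] : Measurable f := by
  have hB : BorelSpace {w : ℕ → FreeLetter α // ∀ n, w (n + 1) ≠ (w n).inv} := inferInstance
  have h2 : Measurable (fun x =>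
      (⟨(f x).1, (f x).2⟩ : {w : ℕ → FreeLetter α // ∀ n, w (n + 1) ≠ (w n).inv})) :=
    (measurable_pi_lambda _ hf).subtype_mk
  intro A hA
  refine h2 ?_
  rw [hB.measurable_eq]
  exact hA

theorem measurableSet_coord (n : ℕ) (b : FreeLetter α) :
    MeasurableSet {w : FreeBoundary α | w.1 n = b} :=
  measurable_coord n (measurableSet_singleton b)

theorem measurableSet_coord_ne (n : ℕ) (b : FreeLetter α) :
    MeasurableSet {w : FreeBoundary α | w.1 n ≠ b} :=
  (measurableSet_coord n b).compl

theorem measurableSet_agree (v : ℕ → FreeLetter α) (n : ℕ) : MeasurableSet (agree v n) := by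
  have : agree v n = ⋂ i, ⋂ (_ : i < n), {w : FreeBoundary α | w.1 i = v i} := by
    ext w
    simp [agree]
  rw [this]
  exact MeasurableSet.iInter fun i => MeasurableSet.iInter fun _ => measurableSet_coord i _

theorem isPiSystem_agree :
    IsPiSystem {s : Set (FreeBoundary α) | ∃ v n, s = agree v n} := by
  rintro _ ⟨v, n, rfl⟩ _ ⟨v', n', rfl⟩ ⟨w, h, h'⟩
  refine ⟨w.1, max n n', ?_⟩
  ext w'
  constructor
  · rintro ⟨h1, h2⟩ i hi
    rcases lt_max_iff.1 hi with hi | hi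
    · rw [h1 i hi, h i hi]
    · rw [h2 i hi, h' i hi]
  · intro h1
    exact ⟨fun i hi => by rw [h1 i (lt_max_of_lt_left hi), h i hi],
      fun i hi => by rw [h1 i (lt_max_of_lt_right hi), h' i hi]⟩

variable [Fintype α]

theorem measurable_tail : Measurable (tail : FreeBoundary α → FreeBoundary α) :=
  measurable_of_coord fun n => measurable_coord (n + 1)

theorem measurable_letterMul (x : FreeLetter α) : Measurable (letterMul x) := by
  classical
  refine measurable_of_coord fun n => ?_
  have : (fun w : FreeBoundary α => (letterMul x w).1 n) = fun w =>
      if w.1 0 = x.inv then w.1 (n + 1) else (Nat.casesOn n x w.1 : FreeLetter α) := by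
    funext w
    by_cases h : w.1 0 = x.inv
    · rw [letterMul, dif_pos h, if_pos h]
      rfl
    · rw [letterMul, dif_neg h, if_neg h]
      rfl
  rw [this]
  refine Measurable.ite (measurableSet_coord 0 _) (measurable_coord _) ?_
  cases n with
  | zero => exact measurable_const
  | succ n => exact measurable_coord n

theorem measurable_smul (g : FreeGroup α) : Measurable fun w : FreeBoundary α => g • w := by
  induction g using FreeLetter.gen_induction with
  | one =>
    simp only [one_smul]
    exact measurable_id
  | mul x g ih =>
    simp only [mul_smul, gen_smul]
    exact (measurable_letterMul x).comp ih

theorem measurableSet_smul (g : FreeGroup α) {A : Set (FreeBoundary α)} (hA : MeasurableSet A) :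
    MeasurableSet (g • A) := by
  rw [← Set.preimage_smul_inv]
  exact measurable_smul g⁻¹ hA

theorem generateFrom_agree : (inferInstance : MeasurableSpace (FreeBoundary α)) =
    MeasurableSpace.generateFrom {s | ∃ v n, s = agree v n} := by
  refine le_antisymm ?_ (MeasurableSpace.generateFrom_le ?_)
  · have h : @Measurable _ _ (MeasurableSpace.generateFrom
        {s : Set (FreeBoundary α) | ∃ v n, s = agree v n}) _ (id : FreeBoundary α → _) := by
      refine @measurable_of_coord α _ (_) _ (fun n => ?_) _
      refine @measurable_to_countable' _ _ _ _ (_) _ fun y => ?_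
      have : (fun w : FreeBoundary α => (id w).1 n) ⁻¹' {y} =
          ⋃ t : Fin (n + 1) → FreeLetter α, ⋃ (_ : t (Fin.last n) = y),
            -- The default value `y` is never read: only the places up to `n` are compared.
            agree (fun i => if h : i < n + 1 then t ⟨i, h⟩ else y) (n + 1) := by
        ext w
        simp only [Set.mem_preimage, Set.mem_singleton_iff, Set.mem_iUnion, exists_prop]
        constructor
        · intro h
          exact ⟨fun i => w.1 i, h, fun i hi => by simp [hi]⟩
        · rintro ⟨t, ht, h⟩
          rw [← ht]
          exact (h n n.lt_succ_self).trans (dif_pos n.lt_succ_self)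
      rw [this]
      exact MeasurableSet.iUnion fun t => MeasurableSet.iUnion fun _ =>
        MeasurableSpace.measurableSet_generateFrom ⟨_, _, rfl⟩
    intro s hs
    exact h hs
  · rintro _ ⟨v, n, rfl⟩
    exact measurableSet_agree v n

end Measurability

/-! ### Markov property of the uniform measure -/

section Measure

variable [Fintype α]

open Classical in
theorem uniformMeasure_agree (w : FreeBoundary α) (n : ℕ) :
    uniformMeasure α (agree w.1 (n + 1)) =
      ((2 * Fintype.card α * (2 * Fintype.card α - 1) ^ n : ℕ) : ℝ≥0∞)⁻¹ := by
  rw [agree_eq_cylinder, uniformMeasure_cylinder, norm_pre, Nat.add_sub_cancel]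
  intro h
  have := norm_pre w (n + 1)
  rw [h] at this
  simp at this

theorem uniformMeasure_letter (b : FreeLetter α) :
    uniformMeasure α {w | w.1 0 = b} = ((2 * Fintype.card α : ℕ) : ℝ≥0∞)⁻¹ := by
  have : {w : FreeBoundary α | w.1 0 = b} = agree (const b).1 (0 + 1) := by
    ext w
    simp [agree, const]
  rw [this, uniformMeasure_agree, pow_zero, mul_one]

open Classical in
theorem measure_inter_ne (μ : Measure (FreeBoundary α)) {B : Set (FreeBoundary α)}
    (hB : MeasurableSet B) (a : FreeLetter α) :
    μ (B ∩ {w | w.1 0 ≠ a}) = ∑ b with b ≠ a, μ (B ∩ {w | w.1 0 = b}) := by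
  rw [← measure_biUnion_finset]
  · congr 1
    ext w
    simp
  · intro b _ c _ hbc
    refine Set.disjoint_left.2 fun w h1 h2 => hbc ?_
    rw [← h1.2, ← h2.2]
  · exact fun b _ => hB.inter (measurableSet_coord 0 b)

/-- The Markov property of the uniform measure. -/
theorem uniformMeasure_tail (hα : 0 < Fintype.card α) (b : FreeLetter α)
    {B : Set (FreeBoundary α)} (hB : MeasurableSet B) :
    uniformMeasure α (tail ⁻¹' B ∩ {w | w.1 0 = b}) =
      ((2 * Fintype.card α - 1 : ℕ) : ℝ≥0∞)⁻¹ *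
        uniformMeasure α (B ∩ {w | w.1 0 ≠ b.inv}) := by
  classical
  have hne : Nonempty α := Fintype.card_pos_iff.1 hα
  set q := 2 * Fintype.card α - 1 with hq
  have hq0 : (q : ℝ≥0∞) ≠ 0 := by
    have : q ≠ 0 := by omega
    exact_mod_cast this
  have hqt : (q : ℝ≥0∞) ≠ ⊤ := ENNReal.natCast_ne_top q
  have hb := measurableSet_coord (α := α) 0 b
  have hb' := measurableSet_coord_ne (α := α) 0 b.inv
  have key : ((uniformMeasure α).restrict {w | w.1 0 = b}).map tail =
      (q : ℝ≥0∞)⁻¹ • (uniformMeasure α).restrict {w | w.1 0 ≠ b.inv} := by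
    -- The total mass also settles the cylinder of length `0`, to which the formula for cylinder
    -- measures does not apply.
    have huniv : ((uniformMeasure α).restrict {w | w.1 0 = b}).map tail Set.univ =
        ((q : ℝ≥0∞)⁻¹ • (uniformMeasure α).restrict {w | w.1 0 ≠ b.inv}) Set.univ := by
      rw [Measure.map_apply measurable_tail MeasurableSet.univ, Measure.smul_apply,
        Measure.restrict_apply (measurable_tail MeasurableSet.univ),
        Measure.restrict_apply MeasurableSet.univ, measure_inter_ne _ MeasurableSet.univ]
      simp only [Set.preimage_univ, Set.univ_inter, uniformMeasure_letter, Finset.sum_const,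
        FreeLetter.card_filter_ne, smul_eq_mul, nsmul_eq_mul]
      rw [← mul_assoc, ENNReal.inv_mul_cancel hq0 hqt, one_mul]
    refine ext_of_generate_finite _ generateFrom_agree isPiSystem_agree ?_ huniv
    rintro _ ⟨v, n, rfl⟩
    cases n with
    | zero =>
      have : agree v 0 = Set.univ := by
        ext w
        simp [agree]
      rw [this, huniv]
    | succ n =>
      have hm := measurableSet_agree v (n + 1)
      rw [Measure.map_apply measurable_tail hm, Measure.smul_apply,
        Measure.restrict_apply (measurable_tail hm), Measure.restrict_apply hm, smul_eq_mul]
      -- Either both sides are measures of cylinders, of lengths `n + 2` and `n + 1`, or both sets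
      -- are empty.
      by_cases hw : (tail ⁻¹' agree v (n + 1) ∩ {w | w.1 0 = b}).Nonempty
      · obtain ⟨w, hw, hwb⟩ := hw
        have h1 : tail ⁻¹' agree v (n + 1) ∩ {w | w.1 0 = b} = agree w.1 (n + 1 + 1) := by
          ext w'
          constructor
          · rintro ⟨h1, h2⟩ i hi
            cases i with
            | zero => exact h2.trans hwb.symm
            | succ i => exact (h1 i (by omega)).trans (hw i (by omega)).symm
          · intro h
            exact ⟨fun i hi => (h (i + 1) (by omega)).trans (hw i hi),
              (h 0 (by omega)).trans hwb⟩
        have h2 : agree v (n + 1) ∩ {w | w.1 0 ≠ b.inv} = agree w.tail.1 (n + 1) := by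
          ext w'
          constructor
          · rintro ⟨h1, h2⟩ i hi
            exact (h1 i hi).trans (hw i hi).symm
          · intro h
            refine ⟨fun i hi => (h i hi).trans (hw i hi), ?_⟩
            change w'.1 0 ≠ b.inv
            rw [h 0 (by omega), ← (show w.1 0 = b from hwb)]
            exact w.2 0
        rw [h1, h2, uniformMeasure_agree, uniformMeasure_agree, ← hq, pow_succ',
          ← ENNReal.mul_inv (Or.inl hq0) (Or.inl hqt), ← Nat.cast_mul, mul_left_comm]
      · have h2 : agree v (n + 1) ∩ {w | w.1 0 ≠ b.inv} = ∅ := by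
          refine Set.eq_empty_of_forall_notMem fun w' h => hw ⟨cons b w' h.2, h.1, rfl⟩
        rw [Set.not_nonempty_iff_eq_empty.1 hw, h2]
        simp
  have := congrArg (fun ν : Measure (FreeBoundary α) => ν B) key
  simpa [Measure.map_apply measurable_tail hB, Measure.restrict_apply (measurable_tail hB),
    Measure.restrict_apply hB] using this

end Measure

end FreeBoundary

/-! ### From equivariant families of sets to subharmonic functions -/

namespace FreeBoundary

variable {α : Type*}

theorem tail_preimage_smul_mem (A : Set (FreeBoundary α)) (g : FreeGroup α) (b : FreeLetter α) :
    {w : FreeBoundary α | g • w ∈ A} ∩ {w | w.1 0 = b} =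
      tail ⁻¹' {w | (g * b.gen) • w ∈ A} ∩ {w | w.1 0 = b} := by
  ext w
  refine and_congr_left fun h => ?_
  change g • w ∈ A ↔ (g * b.gen) • w.tail ∈ A
  rw [mul_smul, gen_smul_tail h]

variable [Fintype α]

/-- A family of sets indexed by the free group, equivariant under a subgroup, supported on
finitely many cosets and compatible with the shift, has constant conditional measures. -/
theorem measure_inter_ne_const (hα : 2 ≤ Fintype.card α) (H : Subgroup (FreeGroup α))
    {D : FreeGroup α → Set (FreeBoundary α)} (hmeas : ∀ g, MeasurableSet (D g))
    (hinv : ∀ h ∈ H, ∀ g, D (h * g) = D g)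
    (hstep : ∀ g (b : FreeLetter α), D g ∩ {w | w.1 0 = b} ⊆ tail ⁻¹' D (g * b.gen))
    {C : Set (FreeGroup α ⧸ H)} (hC : C.Finite)
    (hDC : ∀ g : FreeGroup α, ((g⁻¹ : FreeGroup α) : FreeGroup α ⧸ H) ∉ C → D g = ∅)
    (g g' : FreeGroup α) (a a' : FreeLetter α) :
    uniformMeasure α (D g ∩ {w | w.1 0 ≠ a.inv}) =
      uniformMeasure α (D g' ∩ {w | w.1 0 ≠ a'.inv}) := by
  classical
  have hne : Nonempty α := Fintype.card_pos_iff.1 (by omega)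
  -- `D g` depends only on the right coset `Hg`; inversion turns it into the left coset `g⁻¹H`, on
  -- which the group acts.
  let f : FreeGroup α ⧸ H → FreeLetter α → ℝ := fun u a =>
    (uniformMeasure α (D u.out⁻¹ ∩ {w | w.1 0 ≠ a.inv})).toReal
  have hf : ∀ (g : FreeGroup α) a, f ((g⁻¹ : FreeGroup α) : FreeGroup α ⧸ H) a =
      (uniformMeasure α (D g ∩ {w | w.1 0 ≠ a.inv})).toReal := by
    intro g a
    obtain ⟨h, hh⟩ := QuotientGroup.mk_out_eq_mul H g⁻¹
    simp only [f]
    rw [hh, mul_inv_rev, inv_inv, hinv _ (inv_mem h.2)]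
  have hq0 : ((2 * Fintype.card α - 1 : ℕ) : ℝ≥0∞) ≠ 0 := by
    have : 2 * Fintype.card α - 1 ≠ 0 := by omega
    exact_mod_cast this
  have hsub : ∀ g (a : FreeLetter α), ((2 * Fintype.card α - 1 : ℕ) : ℝ≥0∞) *
      uniformMeasure α (D g ∩ {w | w.1 0 ≠ a.inv}) ≤
      ∑ b with b ≠ a.inv, uniformMeasure α (D (g * b.gen) ∩ {w | w.1 0 ≠ b.inv}) := by
    intro g a
    rw [measure_inter_ne _ (hmeas g), Finset.mul_sum]
    refine Finset.sum_le_sum fun b _ => ?_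
    calc _ ≤ ((2 * Fintype.card α - 1 : ℕ) : ℝ≥0∞) *
          uniformMeasure α (tail ⁻¹' D (g * b.gen) ∩ {w | w.1 0 = b}) := by
          refine mul_le_mul_right (measure_mono ?_) _
          exact Set.subset_inter (hstep g b) Set.inter_subset_right
      _ = _ := by
          rw [uniformMeasure_tail (by omega) b (hmeas _), ← mul_assoc,
            ENNReal.mul_inv_cancel hq0 (ENNReal.natCast_ne_top _), one_mul]
  have hconst := FreeLetter.subharmonic_const hα hC (f := f)
    (fun _ _ => ENNReal.toReal_nonneg) (by
      intro u a hu
      have : D u.out⁻¹ = ∅ := hDC _ (by simpa using hu)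
      simp [f, this]) (by
      intro u a
      have hu : u = (((u.out⁻¹)⁻¹ : FreeGroup α) : FreeGroup α ⧸ H) := by simp
      have h1 := ENNReal.toReal_mono
        (ENNReal.sum_ne_top.2 fun b _ => measure_ne_top _ _) (hsub u.out⁻¹ a)
      rw [ENNReal.toReal_mul, ENNReal.toReal_natCast,
        ENNReal.toReal_sum fun b _ => measure_ne_top _ _] at h1
      refine h1.trans_eq (Finset.sum_congr rfl fun b _ => ?_)
      rw [← hf, mul_inv_rev, inv_inv]
      congr 1
      conv_rhs => rw [hu, inv_inv]
      rfl)
    ((g⁻¹ : FreeGroup α) : FreeGroup α ⧸ H) ((g'⁻¹ : FreeGroup α) : FreeGroup α ⧸ H) a a'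
  rw [hf, hf] at hconst
  exact (ENNReal.toReal_eq_toReal_iff' (measure_ne_top _ _) (measure_ne_top _ _)).1 hconst

/-! ### Finite index: ergodicity and conservativity -/

section FiniteIndex

/-- Each letter read off contributes a factor `q⁻¹` by the Markov property and is absorbed into `g`.
The answer depends only on the length of the cylinder. -/
theorem measure_smul_mem_inter_agree (hα : 0 < Fintype.card α) {A : Set (FreeBoundary α)}
    (hA : MeasurableSet A) {c : ℝ≥0∞}
    (hc : ∀ (g : FreeGroup α) (a : FreeLetter α), uniformMeasure α ({w | g • w ∈ A} ∩ {w | w.1 0 ≠ a.inv}) = c)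
    (n : ℕ) (g : FreeGroup α) (v : FreeBoundary α) :
    uniformMeasure α ({w | g • w ∈ A} ∩ agree v.1 (n + 1)) =
      ((2 * Fintype.card α - 1 : ℕ) : ℝ≥0∞)⁻¹ ^ (n + 1) * c := by
  have hm : ∀ g : FreeGroup α, MeasurableSet {w : FreeBoundary α | g • w ∈ A} :=
    fun g => measurable_smul g hA
  induction n generalizing g v with
  | zero =>
    have : agree v.1 (0 + 1) = {w : FreeBoundary α | w.1 0 = v.1 0} := by
      ext w
      simp [agree]
    rw [this, tail_preimage_smul_mem, uniformMeasure_tail hα _ (hm _), hc, zero_add, pow_one]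
  | succ n ih =>
    have h1 : {w | g • w ∈ A} ∩ agree v.1 (n + 1 + 1) =
        tail ⁻¹' ({w | (g * (v.1 0).gen) • w ∈ A} ∩ agree v.tail.1 (n + 1)) ∩
          {w | w.1 0 = v.1 0} := by
      have h2 : agree v.1 (n + 1 + 1) =
          {w | w.1 0 = v.1 0} ∩ tail ⁻¹' agree v.tail.1 (n + 1) := by
        ext w
        constructor
        · exact fun h => ⟨h 0 (by omega), fun i hi => h (i + 1) (by omega)⟩
        · rintro ⟨h3, h4⟩ i hi
          cases i with
          | zero => exact h3
          | succ i => exact h4 i (by omega)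
      rw [h2, ← Set.inter_assoc, tail_preimage_smul_mem, Set.preimage_inter,
        Set.inter_right_comm]
    have h3 : {w | (g * (v.1 0).gen) • w ∈ A} ∩ agree v.tail.1 (n + 1) ∩
        {w | w.1 0 ≠ (v.1 0).inv} =
        {w | (g * (v.1 0).gen) • w ∈ A} ∩ agree v.tail.1 (n + 1) := by
      refine Set.inter_eq_left.2 fun w hw => ?_
      change w.1 0 ≠ _
      rw [hw.2 0 (by omega)]
      exact v.2 0
    rw [h1, uniformMeasure_tail hα _ ((hm _).inter (measurableSet_agree _ _)), h3, ih,
      ← mul_assoc, ← pow_succ']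

theorem measure_zero_or_of_smul_eq (hα : 2 ≤ Fintype.card α) (H : Subgroup (FreeGroup α))
    [H.FiniteIndex] {A : Set (FreeBoundary α)} (hA : MeasurableSet A)
    (hinv : ∀ g : H, g • A = A) : uniformMeasure α A = 0 ∨ uniformMeasure α Aᶜ = 0 := by
  have hne : Nonempty α := Fintype.card_pos_iff.1 (by omega)
  obtain ⟨x⟩ : Nonempty (FreeLetter α) := inferInstance
  have hD : ∀ A : Set (FreeBoundary α), MeasurableSet A → (∀ g : H, g • A = A) →
      ∀ (g : FreeGroup α) (a : FreeLetter α), uniformMeasure α ({w | g • w ∈ A} ∩ {w | w.1 0 ≠ a.inv}) =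
        uniformMeasure α (A ∩ {w | w.1 0 ≠ x.inv}) := by
    intro A hA hinv g a
    have h1 := measure_inter_ne_const hα H (D := fun g => {w | g • w ∈ A})
      (fun g => measurable_smul g hA) (by
        intro h hh g
        ext w
        change (h * g) • w ∈ A ↔ g • w ∈ A
        conv_lhs => rw [← hinv ⟨h, hh⟩, mul_smul]
        exact Set.smul_mem_smul_set_iff (a := (⟨h, hh⟩ : H)))
      (fun g b => by
        rw [tail_preimage_smul_mem]
        exact Set.inter_subset_left) Set.finite_univ (fun g h => absurd trivial h) g 1 a x
    simpa using h1
  have hU := hD Set.univ MeasurableSet.univ fun g => Set.smul_set_univ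
  simp only [Set.mem_univ, Set.univ_inter, Set.ofPred_true] at hU
  have hcyl := measure_smul_mem_inter_agree (by omega) hA (hD A hA hinv)
  have hcylU := measure_smul_mem_inter_agree (Nat.zero_lt_of_lt hα)
    MeasurableSet.univ (c := uniformMeasure α {w | w.1 0 ≠ x.inv}) (by simpa using hU)
  set c := uniformMeasure α (A ∩ {w | w.1 0 ≠ x.inv}) with hc
  set d := uniformMeasure α {w | w.1 0 ≠ x.inv} with hd
  have hagree : ∀ n (v : FreeBoundary α), d * uniformMeasure α (A ∩ agree v.1 (n + 1)) =
      c * uniformMeasure α (agree v.1 (n + 1)) := by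
    intro n v
    have h1 := hcyl n 1 v
    have h2 := hcylU n 1 v
    simp only [one_smul, Set.mem_univ, Set.ofPred_true, Set.univ_inter, Set.ofPred_mem_eq] at h1 h2
    rw [h1, h2]
    ring
  have hdtop : d ≠ ⊤ := measure_ne_top _ _
  have hctop : c ≠ ⊤ := measure_ne_top _ _
  have hmeas : ∀ B, MeasurableSet B →
      d * uniformMeasure α (A ∩ B) = c * uniformMeasure α B := by
    -- Split off the cylinder of the letter `x⁻¹`, covered by `hagree`; on the rest the identity
    -- reads `d * c = c * d`.
    have huniv : d * uniformMeasure α A = c * uniformMeasure α Set.univ := by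
      have h1 := measure_inter_add_sdiff (μ := uniformMeasure α) A
        (measurableSet_coord_ne 0 x.inv)
      have h2 := measure_inter_add_sdiff (μ := uniformMeasure α) Set.univ
        (measurableSet_coord_ne 0 x.inv)
      have h3 : ({w : FreeBoundary α | w.1 0 ≠ x.inv})ᶜ = agree (const x.inv).1 (0 + 1) := by
        ext w
        simp [agree, const]
      rw [Set.sdiff_eq, h3] at h1 h2
      rw [Set.univ_inter, Set.univ_inter] at h2
      rw [← h1, ← h2, mul_add, mul_add, hagree, ← hc, ← hd, mul_comm d c]
    have hext : (d • (uniformMeasure α).restrict A) = c • uniformMeasure α := by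
      have : IsFiniteMeasure (d • (uniformMeasure α).restrict A) :=
        Measure.smul_finite _ hdtop
      refine ext_of_generate_finite _ generateFrom_agree isPiSystem_agree ?_ ?_
      · rintro _ ⟨v, n, rfl⟩
        rw [Measure.smul_apply, Measure.smul_apply,
          Measure.restrict_apply (measurableSet_agree v n), Set.inter_comm, smul_eq_mul,
          smul_eq_mul]
        rcases (agree v n : Set (FreeBoundary α)).eq_empty_or_nonempty with h | ⟨w, hw⟩
        · simp [h]
        · have h : agree v n = agree w.1 n := by
            ext w'
            exact forall₂_congr fun i hi => by rw [hw i hi]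
          rw [h]
          cases n with
          | zero =>
            have : agree w.1 0 = Set.univ := by
              ext w
              simp [agree]
            rw [this, Set.inter_univ, huniv]
          | succ n => exact hagree n w
      · simpa using huniv
    intro B hB
    have := congrArg (fun ν : Measure (FreeBoundary α) => ν B) hext
    simpa [Measure.restrict_apply hB, Set.inter_comm] using this
  -- Testing on `Aᶜ` gives `c = 0` or `Aᶜ` null; if `c = 0`, testing on the whole space gives `A`
  -- null, because `d ≠ 0`.
  have h1 := hmeas _ hA.compl
  rw [Set.inter_compl_self, measure_empty, mul_zero, eq_comm, mul_eq_zero] at h1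
  refine h1.imp_left fun h => ?_
  have h2 := hmeas _ MeasurableSet.univ
  rw [Set.inter_univ, h, zero_mul, mul_eq_zero] at h2
  refine h2.resolve_left fun h3 => ?_
  have h4 : {w : FreeBoundary α | w.1 0 = x} ⊆ {w | w.1 0 ≠ x.inv} := by
    intro w hw
    change w.1 0 ≠ _
    rw [show w.1 0 = x from hw]
    exact x.ne_inv
  have h5 := measure_mono_null h4 h3
  rw [uniformMeasure_letter, ENNReal.inv_eq_zero] at h5
  exact ENNReal.natCast_ne_top _ h5

theorem countable_freeGroup : Countable (FreeGroup α) :=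
  inferInstanceAs (Countable (Quot _))

theorem isErgodicAction (hα : 2 ≤ Fintype.card α) (H : Subgroup (FreeGroup α))
    [H.FiniteIndex] : IsErgodicAction H (uniformMeasure α) := by
  intro A hA hinv
  have := countable_freeGroup (α := α)
  -- Countability of `H` replaces invariance mod `0` by strict invariance.
  have hae : (⋂ g : H, g • A) =ᵐ[uniformMeasure α] A := by
    have h : (⋂ g : H, g • A) =ᵐ[uniformMeasure α] ⋂ _ : H, A :=
      Filter.EventuallyEq.countable_iInter hinv
    rwa [Set.iInter_const] at h
  rw [← measure_congr hae, ← measure_congr hae.compl]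
  refine measure_zero_or_of_smul_eq hα H
    (MeasurableSet.iInter fun g => measurableSet_smul (g : FreeGroup α) hA) fun g => ?_
  rw [Set.smul_set_iInter]
  simp only [smul_smul]
  exact (Equiv.mulLeft g).iInf_comp (g := fun k : H => k • A)

theorem exists_agree_pos {B : Set (FreeBoundary α)} (hB : uniformMeasure α B ≠ 0) (n : ℕ) :
    ∃ v : FreeBoundary α, uniformMeasure α (B ∩ agree v.1 n) ≠ 0 := by
  by_contra! h
  refine hB (measure_mono_null (t := ⋃ L : List (α × Bool), B ∩ {w | w.word n = L})
    (fun w hw => Set.mem_iUnion.2 ⟨w.word n, hw, rfl⟩) (measure_iUnion_null fun L => ?_))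
  rcases (B ∩ {w | w.word n = L}).eq_empty_or_nonempty with h1 | ⟨v, -, hv⟩
  · rw [h1, measure_empty]
  · rw [setOf_word_eq hv]
    exact h v

theorem exists_agree_lt (hα : 2 ≤ Fintype.card α) {ε : ℝ≥0∞} (hε : ε ≠ 0) :
    ∃ n, ∀ v : FreeBoundary α, uniformMeasure α (agree v.1 n) < ε := by
  obtain ⟨n, hn⟩ := ENNReal.exists_inv_nat_lt hε
  refine ⟨n + 1, fun v => ?_⟩
  rw [uniformMeasure_agree]
  refine (ENNReal.inv_le_inv.2 (Nat.cast_le.2 ?_)).trans_lt hn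
  have h1 : n < (2 * Fintype.card α - 1) ^ n := Nat.lt_pow_self (by omega)
  exact h1.le.trans (Nat.le_mul_of_pos_left _ (by omega))

theorem isConservativeAction (hα : 2 ≤ Fintype.card α) (H : Subgroup (FreeGroup α))
    [H.FiniteIndex] : IsConservativeAction H (uniformMeasure α) := by
  intro A hA _
  refine ⟨hA, ?_⟩
  have := countable_freeGroup (α := α)
  -- The points of `A` that never return.
  let B : Set (FreeBoundary α) := A ∩ ⋂ g : H, ⋂ (_ : g ≠ 1), {w | g • w ∉ A}
  have hBmeas : MeasurableSet B := hA.inter <| MeasurableSet.iInter fun g =>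
    MeasurableSet.iInter fun _ => measurable_smul (g : FreeGroup α) hA.compl
  have hBmem : ∀ w ∈ B, ∀ g : H, g ≠ 1 → g • w ∉ A := fun w hw g hg =>
    Set.mem_iInter₂.1 hw.2 g hg
  suffices h : uniformMeasure α B = 0 by
    rw [ae_iff]
    refine measure_mono_null (fun w hw => ?_) h
    have hw : ¬ (w ∈ A → ∃ g : H, g ≠ 1 ∧ g • w ∈ A) := hw
    push Not at hw
    exact ⟨hw.1, Set.mem_iInter₂.2 hw.2⟩
  by_contra hB
  obtain ⟨n, hn⟩ := exists_agree_lt hα hB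
  obtain ⟨v, hv⟩ := exists_agree_pos hB n
  have hBv : MeasurableSet (B ∩ agree v.1 n) := hBmeas.inter (measurableSet_agree _ _)
  have hinv : ∀ g : H, g • (⋃ k : H, k • (B ∩ agree v.1 n)) = ⋃ k : H, k • (B ∩ agree v.1 n) := by
    intro g
    rw [Set.smul_set_iUnion]
    simp only [smul_smul]
    exact (Equiv.mulLeft g).iSup_comp (g := fun k : H => k • (B ∩ agree v.1 n))
  rcases measure_zero_or_of_smul_eq hα H (MeasurableSet.iUnion fun g : H =>
    measurableSet_smul (g : FreeGroup α) hBv) hinv with h | h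
  · refine hv (measure_mono_null (fun w hw => Set.mem_iUnion.2 ⟨1, ?_⟩) h)
    simpa using hw
  -- The saturation is conull but misses the rest of `B`, so `B` lies mod `0` in a cylinder chosen
  -- to be of smaller measure.
  · have h1 : B \ agree v.1 n ⊆ (⋃ g : H, (g : FreeGroup α) • (B ∩ agree v.1 n))ᶜ := by
      rintro w hw hw'
      obtain ⟨g, b, hb, rfl⟩ := Set.mem_iUnion.1 hw'
      by_cases hg : g = 1
      · subst hg
        exact hw.2 (by simpa using hb.2)
      · exact hBmem b hb.1 g hg hw.1.1
    have h2 := measure_le_inter_add_sdiff (uniformMeasure α) B (agree v.1 n)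
    rw [measure_mono_null h1 h, add_zero] at h2
    exact (h2.trans (measure_mono Set.inter_subset_right)).not_gt (hn v)

end FiniteIndex

end FreeBoundary

/-! ### The invariant subtree of a finitely generated subgroup -/

section Prefixes

variable {α : Type*}

/-- All the prefixes of a (not necessarily reduced) word represent elements of `Y`. -/
def PrefixesIn (Y : Set (FreeGroup α)) (L : List (α × Bool)) : Prop :=
  ∀ i, FreeGroup.mk (L.take i) ∈ Y

/-- Cancelling a pair creates no new prefix values: a prefix reaching past the cancelled pair
equals, in the group, the prefix two letters longer of the original word. -/
theorem PrefixesIn.step {Y : Set (FreeGroup α)} {L L' : List (α × Bool)} (h : PrefixesIn Y L)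
    (hs : FreeGroup.Red.Step L L') : PrefixesIn Y L' := by
  obtain ⟨L₁, L₂, x, b⟩ | _ := hs
  rename_i L₁ L₂ x b
  intro i
  rcases le_total i L₁.length with hi | hi
  · have h1 := h i
    rwa [List.take_append_of_le_length hi] at h1 ⊢
  · obtain ⟨j, rfl⟩ := Nat.exists_eq_add_of_le hi
    have h1 := h (L₁.length + (j + 2))
    rw [List.take_length_add_append, List.take_succ_cons, List.take_succ_cons] at h1
    rw [List.take_length_add_append]
    have h2 : FreeGroup.mk (L₁ ++ (x, b) :: (x, !b) :: L₂.take j) =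
        FreeGroup.mk (L₁ ++ L₂.take j) := Quot.sound FreeGroup.Red.Step.not
    rwa [h2] at h1

theorem PrefixesIn.red {Y : Set (FreeGroup α)} {L L' : List (α × Bool)} (h : PrefixesIn Y L)
    (hs : FreeGroup.Red L L') : PrefixesIn Y L' := by
  induction hs with
  | refl => exact h
  | tail _ hs ih => exact ih.step hs

theorem PrefixesIn.append {Y : Set (FreeGroup α)} {H : Subgroup (FreeGroup α)}
    (hY : ∀ h ∈ H, ∀ g ∈ Y, h * g ∈ Y) {L L' : List (α × Bool)} (h : PrefixesIn Y L)
    (hL : FreeGroup.mk L ∈ H) (h' : PrefixesIn Y L') : PrefixesIn Y (L ++ L') := by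
  intro i
  rcases le_total i L.length with hi | hi
  · rw [List.take_append_of_le_length hi]
    exact h i
  · obtain ⟨j, rfl⟩ := Nat.exists_eq_add_of_le hi
    rw [List.take_length_add_append, ← FreeGroup.mul_mk]
    exact hY _ hL _ (h' j)

open Classical in
/-- A finitely generated subgroup of a free group of finite rank acts cocompactly on a subtree. -/
theorem Subgroup.FG.exists_subtree [Finite α] {H : Subgroup (FreeGroup α)} (hH : H.FG) :
    ∃ Y : Set (FreeGroup α), 1 ∈ Y ∧ (∀ h ∈ H, ∀ g ∈ Y, h * g ∈ Y) ∧
      (∀ g ∈ Y, PrefixesIn Y g.toWord) ∧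
      ((fun g : FreeGroup α => ((g⁻¹ : FreeGroup α) : FreeGroup α ⧸ H)) '' Y).Finite := by
  obtain ⟨S, hS⟩ := hH
  set R := S.sup FreeGroup.norm
  set Y : Set (FreeGroup α) := {g | ∃ h ∈ H, (h⁻¹ * g).norm ≤ R} with hYdef
  have hball : ∀ g : FreeGroup α, g.norm ≤ R → g ∈ Y := fun g hg =>
    ⟨1, one_mem H, by simpa using hg⟩
  have hinv : ∀ h ∈ H, ∀ g ∈ Y, h * g ∈ Y := by
    rintro h hh g ⟨k, hk, hkg⟩
    refine ⟨h * k, mul_mem hh hk, ?_⟩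
    rwa [mul_inv_rev, mul_assoc, inv_mul_cancel_left]
  have hword : ∀ g : FreeGroup α, g.norm ≤ R → PrefixesIn Y g.toWord := by
    intro g hg i
    refine hball _ (FreeGroup.norm_mk_le.trans ?_)
    rw [List.length_take]
    exact (min_le_right _ _).trans hg
  -- Concatenate the words of the generators without reducing: every prefix stays within `R` of a
  -- point of `H`.
  have hclos : ∀ h ∈ H, ∃ L, FreeGroup.mk L = h ∧ PrefixesIn Y L := by
    have hstep : ∀ x ∈ H, x.norm ≤ R → ∀ y, (∃ L, FreeGroup.mk L = y ∧ PrefixesIn Y L) →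
        ∃ L, FreeGroup.mk L = x * y ∧ PrefixesIn Y L := by
      rintro x hx hxR _ ⟨L, rfl, hL⟩
      refine ⟨x.toWord ++ L, ?_, (hword x hxR).append hinv ?_ hL⟩
      · rw [← FreeGroup.mul_mk, FreeGroup.mk_toWord]
      · rwa [FreeGroup.mk_toWord]
    have hSH : ∀ x ∈ S, x ∈ H ∧ x.norm ≤ R := fun x hx =>
      ⟨hS ▸ Subgroup.subset_closure hx, Finset.le_sup (f := FreeGroup.norm) hx⟩
    intro h hh
    rw [← hS] at hh
    induction hh using Subgroup.closure_induction_left with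
    | one => exact ⟨[], rfl, fun i => by
      rw [List.take_nil]
      exact hball 1 (by simp)⟩
    | mul_left x hx y hy ih => exact hstep x (hSH x hx).1 (hSH x hx).2 y ih
    | inv_mul_cancel x hx y hy ih =>
      exact hstep _ (inv_mem (hSH x hx).1) (by simpa using (hSH x hx).2) y ih
  refine ⟨Y, hball 1 (by simp), hinv, ?_, ?_⟩
  · rintro g ⟨h, hh, hg⟩
    obtain ⟨L, hL, hLY⟩ := hclos h hh
    -- Go from `1` to `h` inside `Y`, then from `h` to `g` within distance `R` of `h`; reducing this
    -- path gives the word of `g`.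
    have h1 := hLY.append hinv (hL ▸ hh) (hword _ hg)
    have h2 : FreeGroup.mk (L ++ (h⁻¹ * g).toWord) = g := by
      rw [← FreeGroup.mul_mk, FreeGroup.mk_toWord, hL, mul_inv_cancel_left]
    rw [← h2, FreeGroup.toWord_mk]
    exact h1.red FreeGroup.reduce.red
  · have hfin : {g : FreeGroup α | g.norm ≤ R}.Finite := by
      refine ((List.finite_length_le (α × Bool) R).image FreeGroup.mk).subset fun g hg => ?_
      exact ⟨g.toWord, hg, FreeGroup.mk_toWord⟩
    refine (hfin.image fun g : FreeGroup α =>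
      ((g⁻¹ : FreeGroup α) : FreeGroup α ⧸ H)).subset ?_
    rintro _ ⟨g, ⟨h, hh, hg⟩, rfl⟩
    refine ⟨h⁻¹ * g, hg, ?_⟩
    simpa using QuotientGroup.mk_mul_of_mem g⁻¹ hh

end Prefixes

/-! ### Infinite index: exit from the subtree and dissipativity -/

namespace FreeBoundary

variable {α : Type*}

/-- The ray from `1` to `g • w` and the translate by `g` of the ray from `1` to `w` eventually
coincide, and they meet on any path from `1` to `g`. -/
theorem exists_pre_smul (L : List (α × Bool)) (w : FreeBoundary α) :
    ∃ m k i, (∀ j, (FreeGroup.mk L • w).pre (m + j) = FreeGroup.mk L * w.pre (k + j)) ∧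
      (FreeGroup.mk L • w).pre m = FreeGroup.mk (L.take i) := by
  induction L with
  | nil => exact ⟨0, 0, 0, fun j => by rw [← FreeGroup.one_eq_mk, one_smul, one_mul], rfl⟩
  | cons x L ih =>
    obtain ⟨m, k, i, h1, h2⟩ := ih
    obtain ⟨y, hx, htake⟩ : ∃ y : FreeLetter α, FreeGroup.mk (x :: L) = y.gen * FreeGroup.mk L ∧
        ∀ i, FreeGroup.mk ((x :: L).take (i + 1)) = y.gen * FreeGroup.mk (L.take i) :=
      ⟨x, rfl, fun _ => rfl⟩
    set v := FreeGroup.mk L • w with hv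
    have hsmul : FreeGroup.mk (x :: L) • w = letterMul y v := by
      rw [hx, mul_smul, ← hv, gen_smul]
    rw [hsmul, hx]
    by_cases h : v.1 0 = y.inv
    · have hpre : ∀ n, (letterMul y v).pre n = y.gen * v.pre (n + 1) := by
        intro n
        rw [letterMul, dif_pos h, pre_succ, h, FreeLetter.gen_inv, mul_inv_cancel_left]
      -- When `y` cancels, the meeting point comes one step closer to the origin; if it was the
      -- origin itself, it moves one step along the ray of `w` instead, whence `k + 1`.
      cases m with
      | zero =>
        refine ⟨0, k + 1, 0, fun j => ?_, rfl⟩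
        rw [hpre, mul_assoc, add_right_comm, add_assoc k, ← h1]
        congr 2
        omega
      | succ m =>
        refine ⟨m, k, i + 1, fun j => ?_, ?_⟩
        · rw [hpre, mul_assoc, ← h1]
          congr 2
          omega
        · rw [hpre, h2, htake]
    · have hpre : ∀ n, (letterMul y v).pre (n + 1) = y.gen * v.pre n := by
        intro n
        rw [letterMul, dif_neg h, pre_succ]
        rfl
      refine ⟨m + 1, k, i + 1, fun j => ?_, ?_⟩
      · rw [add_right_comm, hpre, h1, mul_assoc]
      · rw [hpre, h2, htake]

open Classical in
theorem pre_mem_of_le {Y : Set (FreeGroup α)} (hY : ∀ g ∈ Y, PrefixesIn Y g.toWord)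
    {w : FreeBoundary α} {i n : ℕ} (hn : w.pre n ∈ Y) (hin : i ≤ n) : w.pre i ∈ Y := by
  have := hY _ hn i
  rwa [toWord_pre, take_word w hin] at this

/-- The ray from `1` to `w` leaves `Y` at the point `g`. -/
def ExitsAt (Y : Set (FreeGroup α)) (w : FreeBoundary α) (g : FreeGroup α) : Prop :=
  ∃ n, w.pre n = g ∧ w.pre n ∈ Y ∧ w.pre (n + 1) ∉ Y

open Classical in
theorem ExitsAt.unique {Y : Set (FreeGroup α)} (hY : ∀ g ∈ Y, PrefixesIn Y g.toWord)
    {w : FreeBoundary α} {g g' : FreeGroup α} (h : ExitsAt Y w g) (h' : ExitsAt Y w g') :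
    g = g' := by
  obtain ⟨n, rfl, h1, h2⟩ := h
  obtain ⟨n', rfl, h1', h2'⟩ := h'
  have h3 : ¬ n + 1 ≤ n' := fun h => h2 (pre_mem_of_le hY h1' h)
  have h4 : ¬ n' + 1 ≤ n := fun h => h2' (pre_mem_of_le hY h1 h)
  rw [show n = n' by omega]

theorem exists_exitsAt {Y : Set (FreeGroup α)} (h1 : 1 ∈ Y) {w : FreeBoundary α}
    (hw : ¬ ∀ n, w.pre n ∈ Y) : ∃ g, ExitsAt Y w g := by
  by_contra! h
  refine hw fun n => ?_
  induction n with
  | zero => exact h1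
  | succ n ih =>
    by_contra h2
    exact h _ ⟨n, rfl, ih, h2⟩

-- The translated ray and the ray to `h • w` merge at a prefix of `h`, which lies in `Y`. By
-- convexity the exit occurs no earlier than this point, hence on the common part.
open Classical in
theorem ExitsAt.smul {Y : Set (FreeGroup α)} {H : Subgroup (FreeGroup α)} (h1 : 1 ∈ Y)
    (hinv : ∀ h ∈ H, ∀ g ∈ Y, h * g ∈ Y) (hY : ∀ g ∈ Y, PrefixesIn Y g.toWord)
    {w : FreeBoundary α} {g : FreeGroup α} (hw : ExitsAt Y w g) {h : FreeGroup α} (hh : h ∈ H) :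
    ExitsAt Y (h • w) (h * g) := by
  have hinv' : ∀ g, h * g ∈ Y → g ∈ Y := fun g hg => by
    simpa using hinv _ (inv_mem hh) _ hg
  obtain ⟨n, rfl, hn, hn'⟩ := hw
  obtain ⟨m, k, i, hpre, hi⟩ := exists_pre_smul h.toWord w
  rw [FreeGroup.mk_toWord] at hpre hi
  have hm : (h • w).pre m ∈ Y := by
    rw [hi]
    exact hY h (by simpa using hinv h hh 1 h1) i
  have hk : w.pre k ∈ Y := by
    refine hinv' _ ?_
    rw [← add_zero k, ← hpre]
    exact hm
  have hkn : k ≤ n := by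
    by_contra hlt
    exact hn' (pre_mem_of_le hY hk (by omega))
  obtain ⟨j, rfl⟩ := Nat.exists_eq_add_of_le hkn
  refine ⟨m + j, hpre j, ?_, ?_⟩
  · rw [hpre]
    exact hinv h hh _ hn
  · rw [add_assoc, hpre]
    exact fun h2 => hn' (hinv' _ h2)

variable [Fintype α]

theorem measurableSet_pre_mem (n : ℕ) (Y : Set (FreeGroup α)) :
    MeasurableSet {w : FreeBoundary α | w.pre n ∈ Y} := by
  have : {w : FreeBoundary α | w.pre n ∈ Y} =
      ⋃ L : List (α × Bool), ⋃ (_ : FreeGroup.mk L ∈ Y), {w | w.word n = L} := by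
    ext w
    simp [pre]
  rw [this]
  refine MeasurableSet.iUnion fun L => MeasurableSet.iUnion fun _ => ?_
  rcases {w : FreeBoundary α | w.word n = L}.eq_empty_or_nonempty with h1 | ⟨v, hv⟩
  · rw [h1]
    exact MeasurableSet.empty
  · rw [setOf_word_eq hv]
    exact measurableSet_agree _ _

/-- Infinite index provides a vertex off `Y`. No ray from it stays in `Y`, so the constant of
`measure_inter_ne_const` is zero. -/
theorem measure_forall_pre_mem (hα : 2 ≤ Fintype.card α) {H : Subgroup (FreeGroup α)}
    (hH : ¬ H.FiniteIndex) {Y : Set (FreeGroup α)} (hinv : ∀ h ∈ H, ∀ g ∈ Y, h * g ∈ Y)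
    (hfin : ((fun g : FreeGroup α => ((g⁻¹ : FreeGroup α) : FreeGroup α ⧸ H)) '' Y).Finite) :
    uniformMeasure α {w | ∀ n, w.pre n ∈ Y} = 0 := by
  have hiff : ∀ h ∈ H, ∀ g, h * g ∈ Y ↔ g ∈ Y := fun h hh g =>
    ⟨fun hg => by simpa using hinv _ (inv_mem hh) _ hg, hinv h hh g⟩
  obtain ⟨g', hg'⟩ : ∃ g, g ∉ Y := by
    by_contra! h
    refine hH ?_
    have : Finite (FreeGroup α ⧸ H) := by
      refine Set.finite_univ_iff.1 (hfin.subset fun u _ => ?_)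
      obtain ⟨g, rfl⟩ := QuotientGroup.mk_surjective u
      exact ⟨g⁻¹, h _, by simp⟩
    exact Subgroup.finiteIndex_of_finite_quotient
  have hconst := measure_inter_ne_const hα H
    (D := fun g => {w : FreeBoundary α | ∀ n, g * w.pre n ∈ Y})
    (fun g => by
      have : {w : FreeBoundary α | ∀ n, g * w.pre n ∈ Y} =
          ⋂ n, {w | w.pre n ∈ {t | g * t ∈ Y}} := by
        ext w
        simp
      rw [this]
      exact MeasurableSet.iInter fun n => measurableSet_pre_mem n _)
    (fun h hh g => by
      ext w
      exact forall_congr' fun n => by rw [mul_assoc, hiff h hh])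
    (by
      -- Only an inclusion holds: the tail forgets the condition `g ∈ Y`. Hence subharmonic rather
      -- than harmonic.
      rintro g b w ⟨hw, rfl⟩ n
      rw [mul_assoc, ← pre_succ]
      exact hw (n + 1)) hfin
    (fun g hg => Set.eq_empty_of_forall_notMem fun w hw =>
      hg ⟨g, by simpa using hw 0, rfl⟩)
  refine measure_mono_null (t := ⋃ a : FreeLetter α,
    {w : FreeBoundary α | ∀ n, 1 * w.pre n ∈ Y} ∩ {w | w.1 0 ≠ a.inv}) (fun w hw => ?_)
    (measure_iUnion_null fun a => ?_)
  · exact Set.mem_iUnion.2 ⟨w.1 0, fun n => by simpa using hw n, FreeLetter.ne_inv _⟩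
  · rw [hconst 1 g' a a]
    have : {w : FreeBoundary α | ∀ n, g' * w.pre n ∈ Y} = ∅ :=
      Set.eq_empty_of_forall_notMem fun w hw => hg' (by simpa using hw 0)
    rw [this, Set.empty_inter, measure_empty]

theorem isCompletelyDissipativeAction (hα : 2 ≤ Fintype.card α) {H : Subgroup (FreeGroup α)}
    (hfg : H.FG) (hH : ¬ H.FiniteIndex) :
    IsCompletelyDissipativeAction H (uniformMeasure α) := by
  classical
  have := countable_freeGroup (α := α)
  obtain ⟨Y, h1, hinv, hY, hfin⟩ := hfg.exists_subtree
  -- Unique factorization of the exit vertex as an element of `H` times an element of `T` yields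
  -- both disjointness and covering.
  obtain ⟨T, hT, -⟩ := H.exists_isComplement_right 1
  refine ⟨{w | ∃ t ∈ T, ExitsAt Y w t}, ⟨?_, ?_⟩, ?_⟩
  · have : {w : FreeBoundary α | ∃ t ∈ T, ExitsAt Y w t} = ⋃ t ∈ T, ⋃ n,
        {w | w.pre n ∈ ({t} ∩ Y : Set (FreeGroup α))} ∩ {w | w.pre (n + 1) ∈ Yᶜ} := by
      ext w
      simp [ExitsAt, and_assoc]
    rw [this]
    exact MeasurableSet.biUnion (Set.to_countable T) fun t _ => MeasurableSet.iUnion fun n =>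
      (measurableSet_pre_mem n _).inter (measurableSet_pre_mem _ _)
  · intro g h hgh
    refine Set.disjoint_left.2 ?_
    rintro _ ⟨w, ⟨t, ht, hwt⟩, rfl⟩ ⟨w', ⟨t', ht', hwt'⟩, hww⟩
    have h2 : ExitsAt Y ((g : FreeGroup α) • w) (g * t) := hwt.smul h1 hinv hY g.2
    have h3 : ExitsAt Y ((h : FreeGroup α) • w') (h * t') := hwt'.smul h1 hinv hY h.2
    have h4 : (h : FreeGroup α) • w' = (g : FreeGroup α) • w := hww
    rw [h4] at h3
    have h5 := @hT.1 (g, ⟨t, ht⟩) (h, ⟨t', ht'⟩) (h2.unique hY h3)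
    exact hgh (congrArg Prod.fst h5)
  · refine measure_mono_null (fun w hw => ?_) (measure_forall_pre_mem hα hH hinv hfin)
    by_contra hw'
    obtain ⟨g, hg⟩ := exists_exitsAt h1 hw'
    obtain ⟨⟨h, t⟩, rfl⟩ := hT.2 g
    refine hw (Set.mem_iUnion.2 ⟨h, (h : FreeGroup α)⁻¹ • w, ⟨t, t.2, ?_⟩, ?_⟩)
    · simpa using hg.smul h1 hinv hY (inv_mem h.2)
    · exact smul_inv_smul (h : FreeGroup α) w

end FreeBoundary

theorem mainTheorem6 {α : Type*} [Fintype α] (hα : 2 ≤ Fintype.card α)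
    (H : Subgroup (FreeGroup α)) (hH : H.FG) :
    (H.FiniteIndex ∧ IsErgodicAction H (FreeBoundary.uniformMeasure α) ∧
        IsConservativeAction H (FreeBoundary.uniformMeasure α)) ∨
      (¬ H.FiniteIndex ∧ IsCompletelyDissipativeAction H (FreeBoundary.uniformMeasure α)) := by
  by_cases h : H.FiniteIndex
  · exact Or.inl ⟨h, FreeBoundary.isErgodicAction hα H, FreeBoundary.isConservativeAction hα H⟩
  · exact Or.inr ⟨h, FreeBoundary.isCompletelyDissipativeAction hα hH h⟩
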